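/- For $n\ge 1$ let $C_n\subset\mathbb{R}^{m_n}$ be a finite-dimensional simplicial cone, i.e. the set of all linear combinations with coefficients in $\mathbb{R}_+=[0,\infty)$ of finitely many linearly independent vectors, and let \[C_1\xleftarrow{f_1}C_2\xleftarrow{f_2}C_3\xleftarrow{f_3}\cdots\] be an inverse system whose maps are linear (additive and $\mathbb{R}_+$-homogeneous) and satisfy: $f_n(v)=0$ only if $v=0$. Let $\mathcal C=\{(v_n)_n\in\prod_n C_n : f_n(v_{n+1})=v_n\text{ for all }n\}$ be its inverse limit, a convex cone in $\prod_n\mathbb{R}^{m_n}$ with the product topology. A \emph{base} of a convex cone $C$ in a topological vector space is a compact convex subset $B\subset C$ with $0\notin B$ that meets each ray $\{rv: r\ge 0\}$, $v\in C\setminus\{0\}$, in exactly one point (so the empty set is the base of the cone $\{0\}$). Let $B_1$ be a base of $C_1$, and for $n\geq 1$ let $B_n=f_{1n}^{-1}(B_1)\subset C_n$, where $f_{1n}=f_1\circ f_2\circ\cdots\circ f_{n-1}:C_n\to C_1$ (and $f_{11}=\mathrm{id}$). Then each $B_n$ is a base of $C_n$, and the inverse limit \[\mathcal B=\varprojlim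 B_n=\{(v_n)_n\in\mathcal C : v_n\in B_n\text{ for all }n\}\] is a base of $\mathcal C$. Moreover $\mathcal B$ is a compact metrizable Choquet simplex: it is compact, metrizable and convex, and for every $c\in\mathcal B$ there is exactly one Borel probability measure $\nu$ supported on the set $\operatorname{Ext}(\mathcal B)$ of extreme points of $\mathcal B$ such that $g(c)=\int_{\operatorname{Ext}(\mathcal B)}g\,d\nu$ for every continuous affine function $g:\mathcal B\to\mathbb{R}$. -/

import Mathlib

open MeasureTheory

/-- A base of a convex cone `C`: a compact convex subset of `C` that does not contain `0` and meets
every ray `{r • v | r ≥ 0}`, `v ∈ C \ {0}`, in exactly one point. -/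
structure IsConeBase {E : Type*} [AddCommGroup E] [Module ℝ E] [TopologicalSpace E]
    (C : PointedCone ℝ E) (B : Set E) : Prop where
  subset : B ⊆ (C : Set E)
  isCompact : IsCompact B
  convex : Convex ℝ B
  zero_notMem : (0 : E) ∉ B
  existsUnique_mem_ray : ∀ v ∈ C, v ≠ 0 → ∃! x : E, x ∈ B ∧ ∃ r : ℝ, 0 ≤ r ∧ x = r • v

/-- `f` is affine on the convex set `B` (its values outside `B` are irrelevant). -/
def IsAffineOn {E : Type*} [AddCommGroup E] [Module ℝ E] (B : Set E) (f : E → ℝ) : Prop :=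
  ∀ x ∈ B, ∀ y ∈ B, ∀ r s : ℝ, 0 ≤ r → 0 ≤ s → r + s = 1 →
    f (r • x + s • y) = r * f x + s * f y

/-- `ν` is a Borel probability measure supported on the extreme points of `B` that represents the
point `c`: `f c = ∫_{Ext B} f dν` for every continuous affine function `f` on `B`. -/
structure IsExtremeRepresentingMeasure {E : Type*} [AddCommGroup E] [Module ℝ E]
    [TopologicalSpace E] [MeasurableSpace E] (B : Set E) (c : E) (ν : Measure E) : Prop where
  isProbabilityMeasure : IsProbabilityMeasure ν
  supported : ν (B.extremePoints ℝ)ᶜ = 0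
  represents : ∀ f : E → ℝ, ContinuousOn f B → IsAffineOn B f →
    f c = ∫ x in B.extremePoints ℝ, f x ∂ν

/-- A Choquet simplex in a metrizable locally convex space: a compact convex set each of whose
points is represented by exactly one Borel probability measure supported on the extreme points. -/
structure IsChoquetSimplex {E : Type*} [AddCommGroup E] [Module ℝ E] [TopologicalSpace E]
    [IsTopologicalAddGroup E] [ContinuousSMul ℝ E] [LocallyConvexSpace ℝ E]
    [TopologicalSpace.MetrizableSpace E] [MeasurableSpace E] [BorelSpace E]
    (B : Set E) : Prop where
  isCompact : IsCompact B
  convex : Convex ℝ B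
  existsUnique_measure : ∀ c ∈ B, ∃! ν : Measure E, IsExtremeRepresentingMeasure B c ν

section InverseSystem

/-- The composite `f 0 ∘ f 1 ∘ ⋯ ∘ f (n - 1) : C n → C 0` of the transition maps. -/
def toFirst {m : ℕ → ℕ} {C : ∀ n, PointedCone ℝ (Fin (m n) → ℝ)}
    (f : ∀ n, C (n + 1) →ₗ[{r : ℝ // 0 ≤ r}] C n) :
    ∀ n, C n →ₗ[{r : ℝ // 0 ≤ r}] C 0
  | 0 => LinearMap.id
  | n + 1 => (toFirst f n).comp (f n)

/-- The preimage in `C n` of a subset `B` of the first cone `C 0`. -/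
def pullbackBase {m : ℕ → ℕ} {C : ∀ n, PointedCone ℝ (Fin (m n) → ℝ)}
    (f : ∀ n, C (n + 1) →ₗ[{r : ℝ // 0 ≤ r}] C n) (B : Set (Fin (m 0) → ℝ)) (n : ℕ) :
    Set (Fin (m n) → ℝ) :=
  {x | ∃ hx : x ∈ C n, (toFirst f n ⟨x, hx⟩ : Fin (m 0) → ℝ) ∈ B}

/-- The inverse limit of the cones `C n`, as a convex cone in the product of the ambient spaces:
all `(x n)` with `x n ∈ C n` and `f n (x (n + 1)) = x n` for every `n`. -/
def limitCone {m : ℕ → ℕ} {C : ∀ n, PointedCone ℝ (Fin (m n) → ℝ)}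
    (f : ∀ n, C (n + 1) →ₗ[{r : ℝ // 0 ≤ r}] C n) :
    PointedCone ℝ (∀ n, Fin (m n) → ℝ) where
  carrier := {x | ∃ hx : ∀ n, x n ∈ C n, ∀ n, f n ⟨x (n + 1), hx (n + 1)⟩ = ⟨x n, hx n⟩}
  add_mem' := by
    rintro x y ⟨hx, hfx⟩ ⟨hy, hfy⟩
    refine ⟨fun n => (C n).add_mem (hx n) (hy n), fun n => ?_⟩
    have h := (f n).map_add ⟨x (n + 1), hx (n + 1)⟩ ⟨y (n + 1), hy (n + 1)⟩
    rw [hfx n, hfy n] at h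
    exact h
  zero_mem' := ⟨fun n => (C n).zero_mem, fun n => (f n).map_zero⟩
  smul_mem' := by
    rintro r x ⟨hx, hfx⟩
    refine ⟨fun n => Submodule.smul_mem (C n) r (hx n), fun n => ?_⟩
    have h := (f n).map_smul r ⟨x (n + 1), hx (n + 1)⟩
    rw [hfx n] at h
    exact h

/-- The inverse limit of subsets `B n` of the cones `C n` under the restricted transition maps. -/
def limitSet {m : ℕ → ℕ} {C : ∀ n, PointedCone ℝ (Fin (m n) → ℝ)}
    (f : ∀ n, C (n + 1) →ₗ[{r : ℝ // 0 ≤ r}] C n) (B : ∀ n, Set (Fin (m n) → ℝ)) :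
    Set (∀ n, Fin (m n) → ℝ) :=
  {x | x ∈ limitCone f ∧ ∀ n, x n ∈ B n}

end InverseSystem

/-! A base is the level set `φ = 1` of a strictly positive functional on the cone. Pulled back along
the transition maps, which kill only `0`, this functional cuts out a compact simplex in every `C n`,
and the limit set is both the inverse limit of these simplices and a level set in the limit cone.
What remains concerns an inverse limit of simplices under affine maps.

Split the level-`n` component of `c` into vertices with its barycentric coordinates. A vertex need
not lift to the limit, so it is padded with zeros above level `n`. `S.approx n H c` is the integral
of `H` against this discrete measure, and it is linear in `c` because the coordinates are.
Ultrafilter limits of these measures are carried by the limit set and represent `c`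
(`exists_measure`).

Uniqueness: an extreme point is represented only by its Dirac measure, so `S.approx n H` tends to
`H` there, and dominated convergence recovers `∫ H` from `c` alone. Existence: for `H` a squared
coordinate, Jensen's inequality makes `S.approx n H` eventually decrease to some `G ≥ H`. The limit
measure gives `G` and `H` equal integrals, so `G = H` almost everywhere, and strict convexity makes
points where this holds for all squared coordinates extreme. -/

open Filter Topology

/-! ### Limits of discrete measures, and barycenters -/

/-- Finitely supported probability measures on a compact set have limits along ultrafilters. -/
theorem exists_limit_measure {E : Type*} [TopologicalSpace E] [T2Space E] [MeasurableSpace E]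
    [BorelSpace E] {K : Set E} (hK : IsCompact K) (U : Ultrafilter ℕ) {ι : ℕ → Type*}
    [∀ n, Fintype (ι n)] (w : ∀ n, ι n → ℝ) (p : ∀ n, ι n → E) (hw : ∀ n i, 0 ≤ w n i)
    (hw1 : ∀ n, ∑ i, w n i = 1) (hp : ∀ n i, p n i ∈ K) :
    ∃ ν : Measure E, IsProbabilityMeasure ν ∧ ν Kᶜ = 0 ∧ ∀ g : E → ℝ, Continuous g →
      Tendsto (fun n => ∑ i, w n i * g (p n i)) U (𝓝 (∫ x, g x ∂ν)) := by
  have : CompactSpace K := isCompact_iff_compactSpace.1 hK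
  -- Every bounded real sequence converges along an ultrafilter, so the limits exist for all `g` at
  -- once and form a positive functional for the Riesz theorem.
  have hlim : ∀ g : CompactlySupportedContinuousMap K ℝ, ∃ l : ℝ,
      Tendsto (fun n => ∑ i, w n i * g ⟨p n i, hp n i⟩) U (𝓝 l) := by
    intro g
    obtain ⟨M, hM⟩ := isCompact_univ.exists_bound_of_continuousOn g.continuous.continuousOn
    have hmem : ∀ n, (∑ i, w n i * g ⟨p n i, hp n i⟩) ∈ Set.Icc (-M) M := by
      intro n
      rw [Set.mem_Icc, ← abs_le]
      calc |∑ i, w n i * g ⟨p n i, hp n i⟩| ≤ ∑ i, |w n i * g ⟨p n i, hp n i⟩| :=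
            Finset.abs_sum_le_sum_abs _ _
        _ ≤ ∑ i, w n i * M := by
            refine Finset.sum_le_sum fun i _ => ?_
            rw [abs_mul, abs_of_nonneg (hw n i)]
            exact mul_le_mul_of_nonneg_left (hM _ (Set.mem_univ _)) (hw n i)
        _ = M := by rw [← Finset.sum_mul, hw1, one_mul]
    obtain ⟨l, _, hl⟩ := isCompact_Icc.ultrafilter_le_nhds'
      (U.map fun n => ∑ i, w n i * g ⟨p n i, hp n i⟩) (by
        exact Filter.mem_map.2 (Filter.univ_mem' hmem))
    exact ⟨l, hl⟩
  choose Λ hΛ using hlim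
  let T : CompactlySupportedContinuousMap K ℝ →ₗ[ℝ] ℝ :=
    { toFun := Λ
      map_add' := fun g h => tendsto_nhds_unique (hΛ (g + h))
        (((hΛ g).add (hΛ h)).congr fun n => by
          simp [mul_add, Finset.sum_add_distrib])
      map_smul' := fun r g => tendsto_nhds_unique (hΛ (r • g))
        (((hΛ g).const_mul r).congr fun n => by
          simp only [Finset.mul_sum, CompactlySupportedContinuousMap.smul_apply, smul_eq_mul]
          exact Finset.sum_congr rfl fun i _ => by ring) }
  let P := PositiveLinearMap.mk₀ T fun g hg =>
    ge_of_tendsto (hΛ g) (Eventually.of_forall fun n =>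
      Finset.sum_nonneg fun i _ => mul_nonneg (hw n i) (CompactlySupportedContinuousMap.le_def.1 hg _))
  have key : ∀ g : CompactlySupportedContinuousMap K ℝ,
      Tendsto (fun n => ∑ i, w n i * g ⟨p n i, hp n i⟩) U
        (𝓝 (∫ x, g x ∂(RealRMK.rieszMeasure P))) := by
    intro g
    rw [RealRMK.integral_rieszMeasure]
    exact hΛ g
  have hemb : MeasurableEmbedding (Subtype.val : K → E) :=
    MeasurableEmbedding.subtype_coe hK.isClosed.measurableSet
  refine ⟨(RealRMK.rieszMeasure P).map Subtype.val, ?_, ?_, ?_⟩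
  · have h1 := key (CompactlySupportedContinuousMap.continuousMapEquiv (ContinuousMap.const K 1))
    simp only [CompactlySupportedContinuousMap.continuousMapEquiv_apply_toFun,
      ContinuousMap.const_apply, mul_one, hw1, integral_const, smul_eq_mul] at h1
    have h2 := tendsto_nhds_unique h1 tendsto_const_nhds
    rw [Measure.real, ENNReal.toReal_eq_one_iff] at h2
    have : IsProbabilityMeasure (RealRMK.rieszMeasure P) := ⟨h2⟩
    exact Measure.isProbabilityMeasure_map hemb.measurable.aemeasurable
  · rw [hemb.map_apply]
    simp
  · intro g hg
    rw [hemb.integral_map]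
    exact key (CompactlySupportedContinuousMap.continuousMapEquiv
      ⟨fun x => g x, hg.comp continuous_subtype_val⟩)

/-- A continuous function is integrable for a finite measure supported on a compact set. -/
theorem integrable_of_continuousOn_compact {E F : Type*} [TopologicalSpace E] [T2Space E]
    [MeasurableSpace E] [BorelSpace E] [NormedAddCommGroup F] [SecondCountableTopologyEither E F]
    {K : Set E} (hK : IsCompact K) {ν : Measure E} [IsFiniteMeasure ν] (hν : ν Kᶜ = 0)
    {g : E → F} (hg : ContinuousOn g K) : Integrable g ν := by
  have h := hg.integrableOn_compact' (μ := ν) hK hK.isClosed.measurableSet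
  rwa [IntegrableOn, Measure.restrict_eq_self_of_ae_mem] at h
  exact hν

/-- If `c` is the barycenter of `ν` (tested on continuous linear functionals), then continuous
affine functions on the compact convex set carrying `ν` satisfy the barycenter formula. -/
theorem IsAffineOn.eq_integral {E : Type*} [AddCommGroup E] [Module ℝ E] [TopologicalSpace E]
    [IsTopologicalAddGroup E] [ContinuousSMul ℝ E] [LocallyConvexSpace ℝ E] [T2Space E]
    [SecondCountableTopology E] [MeasurableSpace E] [BorelSpace E] {B : Set E}
    (hB : IsCompact B) (hBc : Convex ℝ B) {ν : Measure E} [IsProbabilityMeasure ν]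
    (hν : ν Bᶜ = 0) {c : E} (hc : ∀ l : E →L[ℝ] ℝ, ∫ x, l x ∂ν = l c) {f : E → ℝ}
    (hf : ContinuousOn f B) (hfa : IsAffineOn B f) : f c = ∫ x, f x ∂ν := by
  -- The graph of `f` over `B` is compact and convex, so it contains the barycenter of the image of
  -- `ν`; otherwise Hahn–Banach would separate them.
  let G : Set (E × ℝ) := (fun x => (x, f x)) '' B
  have hGc : IsCompact G := hB.image_of_continuousOn (continuousOn_id.prodMk hf)
  have hGconv : Convex ℝ G := by
    rintro _ ⟨x, hx, rfl⟩ _ ⟨y, hy, rfl⟩ a b ha hb hab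
    refine ⟨a • x + b • y, hBc hx hy ha hb hab, ?_⟩
    simp [hfa x hx y hy a b ha hb hab]
  have hmem : (c, ∫ x, f x ∂ν) ∈ G := by
    by_contra hnot
    obtain ⟨l, u, hlt, hgt⟩ := geometric_hahn_banach_point_closed hGconv hGc.isClosed hnot
    obtain ⟨τ, hsplit⟩ : ∃ τ : ℝ, ∀ (x : E) (t : ℝ),
        l (x, t) = l.comp (ContinuousLinearMap.inl ℝ E ℝ) x + t * τ := by
      refine ⟨l (0, 1), fun x t => ?_⟩
      have : (x, t) = (x, (0 : ℝ)) + t • ((0 : E), (1 : ℝ)) := by simp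
      rw [this, map_add, map_smul]
      simp
    have hi1 : Integrable (fun x => l.comp (ContinuousLinearMap.inl ℝ E ℝ) x) ν :=
      integrable_of_continuousOn_compact hB hν (ContinuousLinearMap.continuous _).continuousOn
    have hi2 : Integrable f ν := integrable_of_continuousOn_compact hB hν hf
    have hint : ∫ x, l (x, f x) ∂ν = l (c, ∫ x, f x ∂ν) := by
      simp only [hsplit]
      rw [integral_add hi1 (hi2.mul_const _), hc, integral_mul_const]
    have hle : ∫ _, u ∂ν ≤ ∫ x, l (x, f x) ∂ν := by
      refine integral_mono_ae (integrable_const _) ?_ ?_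
      · simp only [hsplit]
        exact hi1.add (hi2.mul_const _)
      · have : ∀ᵐ x ∂ν, x ∈ B := hν
        filter_upwards [this] with x hx
        exact (hgt _ ⟨x, hx, rfl⟩).le
    rw [hint, integral_const] at hle
    simp at hle
    linarith
  obtain ⟨x, _, hx⟩ := hmem
  rw [Prod.mk.injEq] at hx
  rw [← hx.2, hx.1]

/-! ### Simplices in barycentric coordinates -/

/-- The simplex with vertices `v i` and barycentric coordinates `lam i`. -/
def barycentricSimplex {E ι : Type*} [AddCommGroup E] [Module ℝ E] [Fintype ι]
    (v : ι → E) (lam : ι → E →ₗ[ℝ] ℝ) : Set E :=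
  {x | (∀ i, 0 ≤ lam i x) ∧ ∑ i, lam i x = 1 ∧ ∑ i, lam i x • v i = x}

section barycentricSimplex

variable {E ι : Type*} [AddCommGroup E] [Module ℝ E] [Fintype ι]
  {v : ι → E} {lam : ι → E →ₗ[ℝ] ℝ}

theorem map_eq_sum_of_mem_barycentricSimplex {F : Type*} [AddCommGroup F] [Module ℝ F]
    (T : E →ₗ[ℝ] F) {x : E} (hx : x ∈ barycentricSimplex v lam) :
    T x = ∑ i, lam i x • T (v i) := by
  conv_lhs => rw [← hx.2.2]
  simp

theorem map_mem_of_mem_barycentricSimplex {F : Type*} [AddCommGroup F] [Module ℝ F]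
    (T : E →ₗ[ℝ] F) {S : Set F} (hS : Convex ℝ S) (hv : ∀ i, T (v i) ∈ S) {x : E}
    (hx : x ∈ barycentricSimplex v lam) : T x ∈ S := by
  rw [map_eq_sum_of_mem_barycentricSimplex T hx]
  exact hS.sum_mem (fun i _ => hx.1 i) hx.2.1 fun i _ => hv i

theorem convex_barycentricSimplex : Convex ℝ (barycentricSimplex v lam) := by
  rintro x ⟨hx0, hx1, hx2⟩ y ⟨hy0, hy1, hy2⟩ a b ha hb hab
  refine ⟨fun i => ?_, ?_, ?_⟩
  · simpa using add_nonneg (mul_nonneg ha (hx0 i)) (mul_nonneg hb (hy0 i))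
  · simp [Finset.sum_add_distrib, ← Finset.mul_sum, hx1, hy1, hab]
  · simp only [map_add, map_smul, smul_eq_mul, add_smul, mul_smul, Finset.sum_add_distrib,
      ← Finset.smul_sum, hx2, hy2]

theorem isCompact_barycentricSimplex {k : ℕ} {v : ι → Fin k → ℝ}
    {lam : ι → (Fin k → ℝ) →ₗ[ℝ] ℝ} : IsCompact (barycentricSimplex v lam) := by
  have hcont : ∀ i, Continuous (lam i) := fun i => (lam i).continuous_of_finiteDimensional
  have hK : IsCompact ((fun w : ι → ℝ => ∑ i, w i • v i) '' stdSimplex ℝ ι) :=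
    (isCompact_stdSimplex ℝ ι).image (by fun_prop)
  refine hK.of_isClosed_subset ?_ ?_
  · refine IsClosed.inter (s₁ := {x | ∀ i, 0 ≤ lam i x}) ?_ (IsClosed.inter
      (s₁ := {x | ∑ i, lam i x = 1}) (s₂ := {x | ∑ i, lam i x • v i = x}) ?_ ?_)
    · rw [Set.ofPred_forall]
      exact isClosed_iInter fun i => isClosed_le continuous_const (hcont i)
    · exact isClosed_eq (continuous_finsetSum _ fun i _ => hcont i) continuous_const
    · exact isClosed_eq (continuous_finsetSum _ fun i _ => (hcont i).smul continuous_const)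
        continuous_id
  · rintro x ⟨hx0, hx1, hx2⟩
    exact ⟨fun i => lam i x, ⟨hx0, hx1⟩, hx2⟩

end barycentricSimplex

/-! ### Inverse systems of simplices and padded points -/

/-- An inverse system of simplices with affine maps, in barycentric coordinates. -/
structure SimplexSystem (m : ℕ → ℕ) where
  ι : ℕ → Type
  [fintype : ∀ n, Fintype (ι n)]
  vertex : ∀ n, ι n → Fin (m n) → ℝ
  coord : ∀ n, ι n → (Fin (m n) → ℝ) →ₗ[ℝ] ℝ
  map : ∀ n, (Fin (m (n + 1)) → ℝ) →ₗ[ℝ] (Fin (m n) → ℝ)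
  vertex_mem : ∀ n i, vertex n i ∈ barycentricSimplex (vertex n) (coord n)
  map_vertex_mem : ∀ n i, map n (vertex (n + 1) i) ∈ barycentricSimplex (vertex n) (coord n)

namespace SimplexSystem

attribute [instance] SimplexSystem.fintype

variable {m : ℕ → ℕ} (S : SimplexSystem m)

/-- The `n`-th simplex of the system. -/
def simplex (n : ℕ) : Set (Fin (m n) → ℝ) := barycentricSimplex (S.vertex n) (S.coord n)

/-- The inverse limit of the simplices. -/
def limit : Set (∀ n, Fin (m n) → ℝ) :=
  {x | (∀ n, x n ∈ S.simplex n) ∧ ∀ n, S.map n (x (n + 1)) = x n}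

theorem map_mem {n : ℕ} {x : Fin (m (n + 1)) → ℝ} (hx : x ∈ S.simplex (n + 1)) :
    S.map n x ∈ S.simplex n :=
  map_mem_of_mem_barycentricSimplex _ convex_barycentricSimplex (S.map_vertex_mem n) hx

theorem isCompact_simplex (n : ℕ) : IsCompact (S.simplex n) := isCompact_barycentricSimplex

theorem convex_simplex (n : ℕ) : Convex ℝ (S.simplex n) := convex_barycentricSimplex

theorem isClosed_setOf_map_eq (n : ℕ) :
    IsClosed {x : ∀ n, Fin (m n) → ℝ | S.map n (x (n + 1)) = x n} :=
  isClosed_eq ((S.map n).continuous_of_finiteDimensional.comp (continuous_apply _))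
    (continuous_apply _)

theorem isCompact_limit : IsCompact S.limit := by
  have h := isCompact_univ_pi S.isCompact_simplex
  refine h.of_isClosed_subset ?_ fun x hx n _ => hx.1 n
  have : S.limit = Set.univ.pi S.simplex ∩
      ⋂ n, {x : ∀ n, Fin (m n) → ℝ | S.map n (x (n + 1)) = x n} := by
    ext x; simp [limit]
  rw [this]
  exact h.isClosed.inter (isClosed_iInter S.isClosed_setOf_map_eq)

theorem convex_limit : Convex ℝ S.limit := by
  rintro x hx y hy a b ha hb hab
  refine ⟨fun n => S.convex_simplex n (hx.1 n) (hy.1 n) ha hb hab, fun n => ?_⟩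
  simp [hx.2 n, hy.2 n]

/-- Extend a point of the `n`-th space to a thread, by its images below `n` and by `0` above. -/
def pad : ∀ n, (Fin (m n) → ℝ) →ₗ[ℝ] (∀ n, Fin (m n) → ℝ)
  | 0 => LinearMap.single ℝ (fun n => Fin (m n) → ℝ) 0
  | n + 1 => (pad n).comp (S.map n) + LinearMap.single ℝ (fun n => Fin (m n) → ℝ) (n + 1)

theorem pad_apply_of_lt {n j : ℕ} (h : n < j) (y : Fin (m n) → ℝ) : S.pad n y j = 0 := by
  induction n with
  | zero => simp [pad, h.ne']
  | succ n ih => simp [pad, h.ne', ih (Nat.lt_of_succ_lt h)]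

theorem pad_apply_self {n : ℕ} (y : Fin (m n) → ℝ) : S.pad n y n = y := by
  cases n with
  | zero => simp [pad]
  | succ n => simp [pad, S.pad_apply_of_lt (Nat.lt_succ_self n)]

theorem pad_succ_apply {n j : ℕ} (h : j ≠ n + 1) (y : Fin (m (n + 1)) → ℝ) :
    S.pad (n + 1) y j = S.pad n (S.map n y) j := by
  simp [pad, h]

theorem pad_apply_mem {n j : ℕ} (h : j ≤ n) {y : Fin (m n) → ℝ} (hy : y ∈ S.simplex n) :
    S.pad n y j ∈ S.simplex j := by
  induction n with
  | zero =>
    obtain rfl : j = 0 := by omega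
    rwa [pad_apply_self]
  | succ n ih =>
    rcases eq_or_ne j (n + 1) with rfl | hj
    · rwa [pad_apply_self]
    · rw [S.pad_succ_apply hj]
      exact ih (by omega) (S.map_mem hy)

theorem map_pad_apply {n j : ℕ} (h : j < n) (y : Fin (m n) → ℝ) :
    S.map j (S.pad n y (j + 1)) = S.pad n y j := by
  induction n with
  | zero => omega
  | succ n ih =>
    rw [S.pad_succ_apply h.ne]
    rcases eq_or_ne j n with rfl | hj
    · rw [pad_apply_self, pad_apply_self]
    · rw [S.pad_succ_apply (by omega), ih (by omega)]

theorem pad_apply_of_mem_limit {x : ∀ n, Fin (m n) → ℝ} (hx : x ∈ S.limit) {n j : ℕ}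
    (h : j ≤ n) : S.pad n (x n) j = x j := by
  induction n with
  | zero =>
    obtain rfl : j = 0 := by omega
    exact S.pad_apply_self _
  | succ n ih =>
    rcases eq_or_ne j (n + 1) with rfl | hj
    · exact S.pad_apply_self _
    · rw [S.pad_succ_apply hj, hx.2, ih (by omega)]

/-- The product of the simplices with `0` adjoined; it contains all padded vertices. -/
def box : Set (∀ n, Fin (m n) → ℝ) := Set.univ.pi fun n => insert 0 (S.simplex n)

theorem isCompact_box : IsCompact S.box :=
  isCompact_univ_pi fun n => (S.isCompact_simplex n).insert 0

theorem pad_vertex_mem_box (n : ℕ) (i : S.ι n) : S.pad n (S.vertex n i) ∈ S.box := by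
  intro j _
  rcases le_or_gt j n with h | h
  · exact Or.inr (S.pad_apply_mem h (S.vertex_mem n i))
  · exact Or.inl (S.pad_apply_of_lt h _)

/-! ### Discrete approximations and their limit measures -/

/-- The affine function on the limit that factors through the `n`-th simplex and agrees with `H` at
the padded vertices. -/
noncomputable def approx (n : ℕ) (H : (∀ n, Fin (m n) → ℝ) → ℝ) : (∀ n, Fin (m n) → ℝ) →L[ℝ] ℝ :=
  ∑ i, H (S.pad n (S.vertex n i)) •
    (S.coord n i).toContinuousLinearMap.comp
      (ContinuousLinearMap.proj (φ := fun n => Fin (m n) → ℝ) n)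

theorem approx_apply (n : ℕ) (H : (∀ n, Fin (m n) → ℝ) → ℝ) (x : ∀ n, Fin (m n) → ℝ) :
    S.approx n H x = ∑ i, S.coord n i (x n) * H (S.pad n (S.vertex n i)) := by
  simp [approx, mul_comm]

/-- The discrete measure at level `n` has barycenter `S.pad n (x n)`, which tends to `x`; hence
limit measures represent `x`. -/
theorem approx_linear (n : ℕ) (l : (∀ n, Fin (m n) → ℝ) →L[ℝ] ℝ) {x : ∀ n, Fin (m n) → ℝ}
    (hx : x ∈ S.limit) : S.approx n l x = l (S.pad n (x n)) := by
  have h := map_eq_sum_of_mem_barycentricSimplex ((l : (∀ n, Fin (m n) → ℝ) →ₗ[ℝ] ℝ).comp (S.pad n))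
    (hx.1 n)
  rw [approx_apply]
  exact h.symm

theorem tendsto_pad {x : ∀ n, Fin (m n) → ℝ} (hx : x ∈ S.limit) :
    Tendsto (fun n => S.pad n (x n)) atTop (𝓝 x) := by
  rw [tendsto_pi_nhds]
  intro j
  refine tendsto_const_nhds.congr' ?_
  filter_upwards [eventually_ge_atTop j] with n hn
  exact (S.pad_apply_of_mem_limit hx hn).symm

theorem abs_approx_le {H : (∀ n, Fin (m n) → ℝ) → ℝ} {M : ℝ} (hM : ∀ x ∈ S.box, |H x| ≤ M)
    (n : ℕ) {x : ∀ n, Fin (m n) → ℝ} (hx : x ∈ S.limit) : |S.approx n H x| ≤ M := by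
  rw [approx_apply]
  calc |∑ i, S.coord n i (x n) * H (S.pad n (S.vertex n i))|
      ≤ ∑ i, |S.coord n i (x n) * H (S.pad n (S.vertex n i))| := Finset.abs_sum_le_sum_abs _ _
    _ ≤ ∑ i, S.coord n i (x n) * M := by
        refine Finset.sum_le_sum fun i _ => ?_
        rw [abs_mul, abs_of_nonneg ((hx.1 n).1 i)]
        exact mul_le_mul_of_nonneg_left (hM _ (S.pad_vertex_mem_box n i)) ((hx.1 n).1 i)
    _ = M := by rw [← Finset.sum_mul, (hx.1 n).2.1, one_mul]

theorem exists_measure {c : ∀ n, Fin (m n) → ℝ} (hc : c ∈ S.limit) (U : Ultrafilter ℕ)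
    (hU : (U : Filter ℕ) ≤ atTop) :
    ∃ ν : Measure (∀ n, Fin (m n) → ℝ), IsProbabilityMeasure ν ∧ ν S.limitᶜ = 0 ∧
      (∀ l : (∀ n, Fin (m n) → ℝ) →L[ℝ] ℝ, ∫ x, l x ∂ν = l c) ∧
      ∀ H : (∀ n, Fin (m n) → ℝ) → ℝ, Continuous H →
        Tendsto (fun n => S.approx n H c) U (𝓝 (∫ x, H x ∂ν)) := by
  obtain ⟨ν, hν, hνK, hlim⟩ := exists_limit_measure S.isCompact_box U
    (fun n i => S.coord n i (c n)) (fun n i => S.pad n (S.vertex n i))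
    (fun n => (hc.1 n).1) (fun n => (hc.1 n).2.1) S.pad_vertex_mem_box
  simp only [← approx_apply] at hlim
  -- The padded vertices lie outside the limit set, but each condition defining it involves at most
  -- two consecutive levels and holds at all padded vertices of high enough level. Such a condition
  -- is the vanishing of a nonnegative continuous `H`, whose integral is therefore zero.
  have hzero : ∀ (N : ℕ) (H : (∀ n, Fin (m n) → ℝ) → ℝ), Continuous H → (∀ x, 0 ≤ H x) →
      (∀ n ≥ N, ∀ i, H (S.pad n (S.vertex n i)) = 0) → ∀ᵐ x ∂ν, H x = 0 := by
    intro N H hH hpos h0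
    have h1 : Tendsto (fun n => S.approx n H c) U (𝓝 0) := by
      refine tendsto_const_nhds.congr' (hU ?_)
      filter_upwards [eventually_ge_atTop N] with n hn
      simp [approx_apply, h0 n hn]
    have h2 := tendsto_nhds_unique (hlim H hH) h1
    exact (integral_eq_zero_iff_of_nonneg hpos
      (integrable_of_continuousOn_compact S.isCompact_box hνK hH.continuousOn)).1 h2
  refine ⟨ν, hν, ?_, fun l => ?_, hlim⟩
  · have h1 : ∀ᵐ x ∂ν, ∀ n, x n ∈ S.simplex n := by
      rw [ae_all_iff]
      intro j
      filter_upwards [hzero j (fun x => Metric.infDist (x j) (S.simplex j))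
        ((Metric.continuous_infDist_pt _).comp (continuous_apply j))
        (fun _ => Metric.infDist_nonneg)
        (fun n hn i => Metric.infDist_zero_of_mem
          (S.pad_apply_mem hn (S.vertex_mem n i)))] with x hx
      exact ((S.isCompact_simplex j).isClosed.mem_iff_infDist_zero ⟨_, hc.1 j⟩).2 hx
    have h2 : ∀ᵐ x ∂ν, ∀ n, S.map n (x (n + 1)) = x n := by
      rw [ae_all_iff]
      intro j
      filter_upwards [hzero (j + 1) (fun x => ‖S.map j (x (j + 1)) - x j‖)
        ((((S.map j).continuous_of_finiteDimensional.comp (continuous_apply _)).sub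
          (continuous_apply _)).norm)
        (fun _ => norm_nonneg _)
        (fun n hn i => by rw [S.map_pad_apply hn, sub_self, norm_zero])] with x hx
      exact sub_eq_zero.1 (norm_eq_zero.1 hx)
    exact h1.and h2
  · refine tendsto_nhds_unique (hlim l l.continuous) (Tendsto.mono_left ?_ hU)
    simp only [S.approx_linear _ l hc]
    exact (l.continuous.tendsto c).comp (S.tendsto_pad hc)

/-! ### Extreme points and uniqueness of the representing measure -/

theorem integrable_of_continuous {ν : Measure (∀ n, Fin (m n) → ℝ)} [IsFiniteMeasure ν]
    (hν : ν S.limitᶜ = 0) {F : Type*} [NormedAddCommGroup F] {H : (∀ n, Fin (m n) → ℝ) → F}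
    (hH : Continuous H) : Integrable H ν :=
  integrable_of_continuousOn_compact S.isCompact_limit hν hH.continuousOn

/-- Averages are taken level by level because the infinite product carries no norm. Convexity keeps
them in the simplices and linearity keeps them compatible. -/
theorem setAverage_mem_limit {ν : Measure (∀ n, Fin (m n) → ℝ)} [IsProbabilityMeasure ν]
    (hν : ν S.limitᶜ = 0) {A : Set (∀ n, Fin (m n) → ℝ)} (hA : ν A ≠ 0) :
    (fun n => ⨍ y in A, y n ∂ν) ∈ S.limit := by
  have hint : ∀ n, Integrable (fun y : ∀ n, Fin (m n) → ℝ => y n) ν := fun n =>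
    S.integrable_of_continuous hν (continuous_apply n)
  have hae : ∀ᵐ y ∂ν, y ∈ S.limit := hν
  refine ⟨fun n => ?_, fun n => ?_⟩
  · refine (S.convex_simplex n).set_average_mem (S.isCompact_simplex n).isClosed hA
      (measure_ne_top _ _) (ae_restrict_of_ae ?_) (hint n).integrableOn
    filter_upwards [hae] with y hy using hy.1 n
  · have h := (LinearMap.toContinuousLinearMap (S.map n)).integral_comp_comm
      ((hint (n + 1)).integrableOn (s := A))
    simp only [setAverage_eq, map_smul]
    congr 1
    refine h.symm.trans (integral_congr_ae (ae_restrict_of_ae ?_))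
    filter_upwards [hae] with y hy using hy.2 n

/-- An extreme point of the limit is represented only by its Dirac measure. -/
theorem ae_eq_of_mem_extremePoints {x : ∀ n, Fin (m n) → ℝ} (hx : x ∈ S.limit.extremePoints ℝ)
    {ν : Measure (∀ n, Fin (m n) → ℝ)} [IsProbabilityMeasure ν] (hν : ν S.limitᶜ = 0)
    (hbar : ∀ l : (∀ n, Fin (m n) → ℝ) →L[ℝ] ℝ, ∫ y, l y ∂ν = l x) : ∀ᵐ y ∂ν, y = x := by
  have hint : ∀ n, Integrable (fun y : ∀ n, Fin (m n) → ℝ => y n) ν := fun n =>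
    S.integrable_of_continuous hν (continuous_apply n)
  have hbar' : ∀ n, ∫ y, y n ∂ν = x n := by
    intro n
    ext i
    rw [eval_integral fun i => (hint n).eval i]
    exact hbar ((ContinuousLinearMap.proj (φ := fun _ : Fin (m n) => ℝ) i).comp
      (ContinuousLinearMap.proj (φ := fun n => Fin (m n) → ℝ) n))
  have hset : ∀ n (A : Set (∀ n, Fin (m n) → ℝ)), MeasurableSet A →
      ∫ y in A, y n ∂ν = ∫ _ in A, x n ∂ν := by
    intro n A hA
    by_cases h0 : ν A = 0
    · rw [Measure.restrict_eq_zero.2 h0]; simp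
    by_cases h1 : ν Aᶜ = 0
    · rw [Measure.restrict_eq_self_of_ae_mem h1, hbar']
      simp
    -- When `A` and its complement both have positive measure, `x` is a proper convex combination of
    -- the two averages, so extremality makes them equal to `x`.
    have havg : (fun n => ⨍ y in A, y n ∂ν) = x := by
      refine hx.2 (S.setAverage_mem_limit hν h0) (S.setAverage_mem_limit hν h1)
        ⟨ν.real A, ν.real Aᶜ, ?_, ?_, ?_, ?_⟩
      · exact ENNReal.toReal_pos h0 (measure_ne_top _ _)
      · exact ENNReal.toReal_pos h1 (measure_ne_top _ _)
      · rw [measureReal_add_measureReal_compl hA, probReal_univ]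
      · funext n
        simp only [Pi.add_apply, Pi.smul_apply]
        rw [measure_smul_setAverage _ (measure_ne_top _ _),
          measure_smul_setAverage _ (measure_ne_top _ _), integral_add_compl hA (hint n), hbar']
    rw [setIntegral_const, ← measure_smul_setAverage _ (measure_ne_top _ _)]
    exact congrArg _ (congrFun havg n)
  have h : ∀ᵐ y ∂ν, ∀ n, y n = x n := by
    rw [ae_all_iff]
    intro n
    exact (hint n).ae_eq_of_forall_setIntegral_eq _ _ (integrable_const _)
      fun A hA _ => hset n A hA
  filter_upwards [h] with y hy using funext hy

/-- Any ultrafilter limit of the discrete measures represents `x`, hence is the Dirac measure at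
`x`; all ultrafilter limits thus agree. -/
theorem tendsto_approx_of_mem_extremePoints {x : ∀ n, Fin (m n) → ℝ}
    (hx : x ∈ S.limit.extremePoints ℝ) {H : (∀ n, Fin (m n) → ℝ) → ℝ} (hH : Continuous H) :
    Tendsto (fun n => S.approx n H x) atTop (𝓝 (H x)) := by
  rw [tendsto_iff_ultrafilter]
  intro U hU
  obtain ⟨ν, _, hν, hbar, hlim⟩ := S.exists_measure hx.1 U hU
  have h : ∫ y, H y ∂ν = H x := by
    rw [integral_congr_ae (g := fun _ => H x)]
    · simp
    · filter_upwards [S.ae_eq_of_mem_extremePoints hx hν hbar] with y hy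
      rw [hy]
  exact h ▸ hlim H hH

theorem exists_abs_le_on_box {H : (∀ n, Fin (m n) → ℝ) → ℝ} (hH : Continuous H) :
    ∃ M, ∀ x ∈ S.box, |H x| ≤ M :=
  S.isCompact_box.exists_bound_of_continuousOn hH.continuousOn

/-- The sequence depends on `c` and not on `ν`, which is what gives uniqueness. Being linear,
`S.approx n H` takes at `c` the value of its `ν`-integral, so dominated convergence applies. -/
theorem tendsto_approx_of_extreme_measure {c : ∀ n, Fin (m n) → ℝ}
    {ν : Measure (∀ n, Fin (m n) → ℝ)} [IsProbabilityMeasure ν]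
    (hν : ν (S.limit.extremePoints ℝ)ᶜ = 0)
    (hbar : ∀ l : (∀ n, Fin (m n) → ℝ) →L[ℝ] ℝ, ∫ y, l y ∂ν = l c)
    {H : (∀ n, Fin (m n) → ℝ) → ℝ} (hH : Continuous H) :
    Tendsto (fun n => S.approx n H c) atTop (𝓝 (∫ x, H x ∂ν)) := by
  simp only [← hbar]
  obtain ⟨M, hM⟩ := S.exists_abs_le_on_box hH
  have hae : ∀ᵐ x ∂ν, x ∈ S.limit.extremePoints ℝ := hν
  refine tendsto_integral_of_dominated_convergence (fun _ => M)
    (fun n => (S.approx n H).continuous.aestronglyMeasurable) (integrable_const _)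
    (fun n => ?_) ?_
  · filter_upwards [hae] with x hx using S.abs_approx_le hM n hx.1
  · filter_upwards [hae] with x hx using S.tendsto_approx_of_mem_extremePoints hx hH

theorem extreme_measure_unique {c : ∀ n, Fin (m n) → ℝ}
    {ν₁ ν₂ : Measure (∀ n, Fin (m n) → ℝ)} [IsProbabilityMeasure ν₁] [IsProbabilityMeasure ν₂]
    (h₁ : ν₁ (S.limit.extremePoints ℝ)ᶜ = 0) (h₂ : ν₂ (S.limit.extremePoints ℝ)ᶜ = 0)
    (hbar₁ : ∀ l : (∀ n, Fin (m n) → ℝ) →L[ℝ] ℝ, ∫ y, l y ∂ν₁ = l c)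
    (hbar₂ : ∀ l : (∀ n, Fin (m n) → ℝ) →L[ℝ] ℝ, ∫ y, l y ∂ν₂ = l c) : ν₁ = ν₂ :=
  ext_of_forall_integral_eq_of_IsFiniteMeasure fun g =>
    tendsto_nhds_unique (S.tendsto_approx_of_extreme_measure h₁ hbar₁ g.continuous)
      (S.tendsto_approx_of_extreme_measure h₂ hbar₂ g.continuous)

/-! ### Squared coordinates and existence of the representing measure -/

/-- The square of the `i`-th coordinate at level `k`. -/
def coordSq (k : ℕ) (i : Fin (m k)) (x : ∀ n, Fin (m n) → ℝ) : ℝ := x k i ^ 2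

theorem continuous_coordSq (k : ℕ) (i : Fin (m k)) : Continuous (coordSq k i) := by
  unfold coordSq; fun_prop

theorem coordSq_pad_le {k n : ℕ} (i : Fin (m k)) {y : Fin (m n) → ℝ}
    (hy : y ∈ S.simplex n) :
    coordSq k i (S.pad n y) ≤ ∑ j, S.coord n j y * coordSq k i (S.pad n (S.vertex n j)) := by
  have h := map_eq_sum_of_mem_barycentricSimplex
    ((LinearMap.proj i : (Fin (m k) → ℝ) →ₗ[ℝ] ℝ).comp
      ((LinearMap.proj (φ := fun n => Fin (m n) → ℝ) k).comp (S.pad n))) hy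
  simp only [LinearMap.comp_apply, LinearMap.proj_apply, smul_eq_mul] at h
  unfold coordSq
  rw [h]
  exact (even_two.convexOn_pow (𝕜 := ℝ)).map_sum_le (fun j _ => hy.1 j) hy.2.1
    fun _ _ => Set.mem_univ _

theorem coordSq_le_approx {k n : ℕ} (h : k ≤ n) (i : Fin (m k)) {x : ∀ n, Fin (m n) → ℝ}
    (hx : x ∈ S.limit) : coordSq k i x ≤ S.approx n (coordSq k i) x := by
  have h1 := S.coordSq_pad_le i (hx.1 n)
  rw [approx_apply]
  refine le_trans (le_of_eq ?_) h1
  rw [coordSq, coordSq, S.pad_apply_of_mem_limit hx h]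

/-- Mapping the level-`n + 1` vertices down and splitting their images into level-`n` vertices
spreads the discrete measure further, which raises the integral of a convex function. The condition
`k ≤ n` ensures that mapping down leaves the `k`-th component of a padded vertex unchanged. -/
theorem approx_coordSq_succ_le {k n : ℕ} (h : k ≤ n) (i : Fin (m k)) {x : ∀ n, Fin (m n) → ℝ}
    (hx : x ∈ S.limit) : S.approx (n + 1) (coordSq k i) x ≤ S.approx n (coordSq k i) x := by
  have hlin : ∀ y, S.approx n (coordSq k i) (S.pad n y) =
      ∑ j, S.coord n j y * coordSq k i (S.pad n (S.vertex n j)) := fun y => by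
    rw [approx_apply, pad_apply_self]
  have hx' : S.approx n (coordSq k i) x =
      S.approx n (coordSq k i) (S.pad n (S.map n (x (n + 1)))) := by
    rw [hlin, hx.2 n, approx_apply]
  have h1 := map_eq_sum_of_mem_barycentricSimplex
    ((S.approx n (coordSq k i) : (∀ n, Fin (m n) → ℝ) →ₗ[ℝ] ℝ).comp ((S.pad n).comp (S.map n)))
    (hx.1 (n + 1))
  simp only [LinearMap.comp_apply, ContinuousLinearMap.coe_coe, smul_eq_mul] at h1
  rw [hx', h1, approx_apply]
  refine Finset.sum_le_sum fun j _ => mul_le_mul_of_nonneg_left ?_ ((hx.1 (n + 1)).1 j)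
  rw [hlin]
  refine le_trans (le_of_eq ?_) (S.coordSq_pad_le i (S.map_vertex_mem n j))
  rw [coordSq, coordSq, S.pad_succ_apply (by omega)]

theorem exists_tendsto_approx_coordSq {k : ℕ} (i : Fin (m k)) {x : ∀ n, Fin (m n) → ℝ}
    (hx : x ∈ S.limit) :
    ∃ l, coordSq k i x ≤ l ∧ Tendsto (fun n => S.approx n (coordSq k i) x) atTop (𝓝 l) := by
  have hanti : Antitone fun n => S.approx (n + k) (coordSq k i) x :=
    antitone_nat_of_succ_le fun n => by
      rw [Nat.add_right_comm]
      exact S.approx_coordSq_succ_le (Nat.le_add_left _ _) i hx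
  have hlb : ∀ n, coordSq k i x ≤ S.approx (n + k) (coordSq k i) x := fun n =>
    S.coordSq_le_approx (Nat.le_add_left _ _) i hx
  have h := tendsto_atTop_ciInf hanti ⟨_, by rintro _ ⟨n, rfl⟩; exact hlb n⟩
  exact ⟨_, le_ciInf hlb, (tendsto_add_atTop_iff_nat k).1 h⟩

theorem mem_extremePoints_of_tendsto {x : ∀ n, Fin (m n) → ℝ} (hx : x ∈ S.limit)
    (h : ∀ k i, Tendsto (fun n => S.approx n (coordSq k i) x) atTop (𝓝 (coordSq k i x))) :
    x ∈ S.limit.extremePoints ℝ := by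
  refine ⟨hx, ?_⟩
  rintro y hy z hz ⟨a, b, ha, hb, hab, rfl⟩
  have key : ∀ k i, y k i = z k i := by
    intro k i
    -- The limit of the approximations is affine, dominates the square at `y` and `z`, and equals it
    -- at the combination. This reverses the convexity inequality, whose defect is `a * (1 - a) * (y
    -- k i - z k i) ^ 2`.
    have h1 : a * coordSq k i y + b * coordSq k i z ≤ coordSq k i (a • y + b • z) := by
      refine ge_of_tendsto (h k i) ?_
      filter_upwards [eventually_ge_atTop k] with n hn
      rw [map_add, map_smul, map_smul]
      exact add_le_add (mul_le_mul_of_nonneg_left (S.coordSq_le_approx hn i hy) ha.le)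
        (mul_le_mul_of_nonneg_left (S.coordSq_le_approx hn i hz) hb.le)
    simp only [coordSq, Pi.add_apply, Pi.smul_apply, smul_eq_mul] at h1
    obtain rfl : b = 1 - a := by linarith
    have h2 : a * (1 - a) * (y k i - z k i) ^ 2 ≤ 0 := by nlinarith
    have h3 : (y k i - z k i) ^ 2 ≤ 0 := by
      by_contra hcon
      exact absurd h2 (not_le.2 (mul_pos (mul_pos ha hb) (not_le.1 hcon)))
    exact sub_eq_zero.1 (pow_eq_zero_iff two_ne_zero |>.1 (le_antisymm h3 (sq_nonneg _)))
  have hyz : y = z := by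
    funext k i
    exact key k i
  rw [hyz, ← add_smul, hab, one_smul]

theorem exists_extreme_measure {c : ∀ n, Fin (m n) → ℝ} (hc : c ∈ S.limit) :
    ∃ ν : Measure (∀ n, Fin (m n) → ℝ), IsProbabilityMeasure ν ∧
      ν (S.limit.extremePoints ℝ)ᶜ = 0 ∧
      ∀ l : (∀ n, Fin (m n) → ℝ) →L[ℝ] ℝ, ∫ x, l x ∂ν = l c := by
  have hU : (hyperfilter ℕ : Filter ℕ) ≤ atTop := Nat.hyperfilter_le_atTop
  obtain ⟨ν, hprob, hν, hbar, hlim⟩ := S.exists_measure hc (hyperfilter ℕ) hU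
  refine ⟨ν, hprob, ?_, hbar⟩
  have hae : ∀ᵐ x ∂ν, x ∈ S.limit := hν
  have key : ∀ k i, ∀ᵐ x ∂ν,
      Tendsto (fun n => S.approx n (coordSq k i) x) atTop (𝓝 (coordSq k i x)) := by
    intro k i
    obtain ⟨M, hM⟩ := S.exists_abs_le_on_box (continuous_coordSq k i)
    have hG : ∀ x, ∃ l, x ∈ S.limit → coordSq k i x ≤ l ∧
        Tendsto (fun n => S.approx n (coordSq k i) x) atTop (𝓝 l) := by
      intro x
      by_cases hx : x ∈ S.limit
      · obtain ⟨l, hl⟩ := S.exists_tendsto_approx_coordSq i hx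
        exact ⟨l, fun _ => hl⟩
      · exact ⟨0, fun h => absurd h hx⟩
    choose G hG using hG
    have hGlim : ∀ᵐ x ∂ν, Tendsto (fun n => S.approx n (coordSq k i) x) atTop (𝓝 (G x)) := by
      filter_upwards [hae] with x hx using (hG x hx).2
    have hGmeas : AEStronglyMeasurable G ν :=
      aestronglyMeasurable_of_tendsto_ae atTop
        (fun n => (S.approx n (coordSq k i)).continuous.aestronglyMeasurable) hGlim
    have hGint : Integrable G ν := by
      refine Integrable.of_bound hGmeas M ?_
      filter_upwards [hae] with x hx
      exact le_of_tendsto ((hG x hx).2.norm)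
        (Eventually.of_forall fun n => S.abs_approx_le hM n hx)
    have hdom : Tendsto (fun n => ∫ x, S.approx n (coordSq k i) x ∂ν) atTop
        (𝓝 (∫ x, G x ∂ν)) := by
      refine tendsto_integral_of_dominated_convergence (fun _ => M)
        (fun n => (S.approx n (coordSq k i)).continuous.aestronglyMeasurable)
        (integrable_const _) (fun n => ?_) hGlim
      filter_upwards [hae] with x hx using S.abs_approx_le hM n hx
    simp only [hbar] at hdom
    -- Both sides are limits of `S.approx n (coordSq k i) c`: one by the construction of `ν`, the
    -- other by dominated convergence and the barycenter property.
    have heq : ∫ x, coordSq k i x ∂ν = ∫ x, G x ∂ν :=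
      tendsto_nhds_unique (hlim _ (continuous_coordSq k i)) (hdom.mono_left hU)
    have haeeq := (integral_eq_iff_of_ae_le
      (S.integrable_of_continuous hν (continuous_coordSq k i)) hGint
      (by filter_upwards [hae] with x hx using (hG x hx).1)).1 heq
    filter_upwards [haeeq, hGlim] with x hx hx'
    rwa [hx]
  have hall : ∀ᵐ x ∂ν, ∀ k i,
      Tendsto (fun n => S.approx n (coordSq k i) x) atTop (𝓝 (coordSq k i x)) :=
    ae_all_iff.2 fun k => ae_all_iff.2 fun i => key k i
  have : ∀ᵐ x ∂ν, x ∈ S.limit.extremePoints ℝ := by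
    filter_upwards [hae, hall] with x hx hx' using S.mem_extremePoints_of_tendsto hx hx'
  exact this

theorem isChoquetSimplex_limit : IsChoquetSimplex S.limit where
  isCompact := S.isCompact_limit
  convex := S.convex_limit
  existsUnique_measure := by
    intro c hc
    obtain ⟨ν, hprob, hν, hbar⟩ := S.exists_extreme_measure hc
    refine ⟨ν, ⟨hprob, hν, fun f hf hfa => ?_⟩, ?_⟩
    · rw [Measure.restrict_eq_self_of_ae_mem (s := S.limit.extremePoints ℝ) hν]
      exact hfa.eq_integral S.isCompact_limit S.convex_limit
        (measure_mono_null (Set.compl_subset_compl.2 extremePoints_subset) hν) hbar hf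
    · rintro ν' ⟨hprob', hν', hrep'⟩
      refine S.extreme_measure_unique (c := c) hν' hν (fun l => ?_) hbar
      have h := hrep' l l.continuous.continuousOn fun x _ y _ r s _ _ _ => by simp
      rw [Measure.restrict_eq_self_of_ae_mem (s := S.limit.extremePoints ℝ) hν'] at h
      exact h.symm

end SimplexSystem

/-! ### Cone bases and strictly positive functionals -/

section ConeBase

variable {E : Type*} [AddCommGroup E] [Module ℝ E]

theorem IsConeBase.smul_eq_smul [TopologicalSpace E] {C : PointedCone ℝ E} {B : Set E}
    (hB : IsConeBase C B) {x y : E} (hx : x ∈ B) (hy : y ∈ B) {r s : ℝ} (hr : 0 < r)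
    (hs : 0 < s) (h : r • x = s • y) : r = s := by
  have hx0 : x ≠ 0 := fun h0 => hB.zero_notMem (h0 ▸ hx)
  obtain ⟨z, -, hz⟩ := hB.existsUnique_mem_ray (r • x)
    (C.smul_mem hr.le (hB.subset hx)) (smul_ne_zero hr.ne' hx0)
  have h1 := hz x ⟨hx, r⁻¹, (inv_pos.2 hr).le, by rw [inv_smul_smul₀ hr.ne']⟩
  have h2 := hz y ⟨hy, s⁻¹, (inv_pos.2 hs).le, by rw [h, inv_smul_smul₀ hs.ne']⟩
  rw [h2, ← h1, ← sub_eq_zero, ← sub_smul, smul_eq_zero] at h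
  exact sub_eq_zero.1 (h.resolve_right hx0)

/-- A base of a cone is a level set of a strictly positive functional on the cone. -/
theorem IsConeBase.exists_functional [TopologicalSpace E] {C : PointedCone ℝ E} {B : Set E}
    (hB : IsConeBase C B) : ∃ φ : C →ₗ[{r : ℝ // 0 ≤ r}] ℝ, (∀ v, v ≠ 0 → 0 < φ v) ∧
      ∀ x, x ∈ B ↔ ∃ hx : x ∈ C, φ ⟨x, hx⟩ = 1 := by
  -- `P v r` says that `v` lies in `r • B`, with `r = 0` reserved for `v = 0`. Uniqueness on rays
  -- makes `r` a function of `v`, and convexity of `B` makes it additive.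
  let P : E → ℝ → Prop := fun v r => (v = 0 ∧ r = 0) ∨ (0 < r ∧ ∃ x ∈ B, v = r • x)
  have hB0 : ∀ x ∈ B, x ≠ 0 := fun x hx h0 => hB.zero_notMem (h0 ▸ hx)
  have hex : ∀ v : C, ∃ r, P v r := by
    rintro ⟨v, hv⟩
    by_cases h0 : v = 0
    · exact ⟨0, Or.inl ⟨h0, rfl⟩⟩
    · obtain ⟨x, ⟨hx, r, hr, rfl⟩, -⟩ := hB.existsUnique_mem_ray v hv h0
      have hr0 : r ≠ 0 := by
        rintro rfl
        exact hB0 _ hx (zero_smul _ _)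
      exact ⟨r⁻¹, Or.inr ⟨inv_pos.2 (hr.lt_of_ne' hr0), _, hx, (inv_smul_smul₀ hr0 v).symm⟩⟩
  have huniq : ∀ {v r s}, P v r → P v s → r = s := by
    rintro v r s (⟨rfl, rfl⟩ | ⟨hr, x, hx, rfl⟩) (⟨h, rfl⟩ | ⟨hs, y, hy, h⟩)
    · rfl
    · exact absurd h.symm (smul_ne_zero hs.ne' (hB0 y hy))
    · exact absurd h (smul_ne_zero hr.ne' (hB0 x hx))
    · exact hB.smul_eq_smul hx hy hr hs h
  have hadd : ∀ {v w r s}, P v r → P w s → P (v + w) (r + s) := by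
    rintro v w r s (⟨rfl, rfl⟩ | ⟨hr, x, hx, rfl⟩) (⟨rfl, rfl⟩ | ⟨hs, y, hy, rfl⟩)
    · exact Or.inl ⟨add_zero _, add_zero _⟩
    · exact Or.inr ⟨by simpa using hs, y, hy, by simp⟩
    · exact Or.inr ⟨by simpa using hr, x, hx, by simp⟩
    · have hrs : 0 < r + s := add_pos hr hs
      refine Or.inr ⟨hrs, (r / (r + s)) • x + (s / (r + s)) • y,
        hB.convex hx hy (div_pos hr hrs).le (div_pos hs hrs).le ?_, ?_⟩
      · rw [← add_div, div_self hrs.ne']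
      · rw [smul_add, smul_smul, smul_smul, mul_div_cancel₀ _ hrs.ne', mul_div_cancel₀ _ hrs.ne']
  have hsmul : ∀ {v r t}, 0 ≤ t → P v r → P (t • v) (t * r) := by
    rintro v r t ht (⟨rfl, rfl⟩ | ⟨hr, x, hx, rfl⟩)
    · exact Or.inl ⟨smul_zero _, mul_zero _⟩
    · rcases ht.eq_or_lt with rfl | ht
      · exact Or.inl ⟨zero_smul _ _, zero_mul _⟩
      · exact Or.inr ⟨mul_pos ht hr, x, hx, smul_smul _ _ _⟩
  choose φ hφ using hex
  refine ⟨{ toFun := φ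
            map_add' := fun v w => huniq (hφ (v + w)) (hadd (hφ v) (hφ w))
            map_smul' := fun t v => huniq (hφ (t • v)) (hsmul t.2 (hφ v)) }, fun v hv => ?_,
    fun x => ⟨fun hx => ⟨hB.subset hx, huniq (hφ _) (Or.inr ⟨one_pos, x, hx, (one_smul _ _).symm⟩)⟩,
      ?_⟩⟩
  · rcases hφ v with ⟨h, -⟩ | ⟨h, -⟩
    · exact absurd (Subtype.ext h) hv
    · exact h
  · rintro ⟨hx, h⟩
    change φ ⟨x, hx⟩ = 1 at h
    rcases hφ ⟨x, hx⟩ with ⟨-, h0⟩ | ⟨-, y, hy, hxy⟩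
    · rw [h0] at h
      exact absurd h zero_ne_one
    · rw [h, one_smul] at hxy
      rwa [show x = y from hxy]

/-- A compact level set of a strictly positive functional on a cone is a base. -/
theorem isConeBase_of_functional [TopologicalSpace E] {C : PointedCone ℝ E}
    (φ : C →ₗ[{r : ℝ // 0 ≤ r}] ℝ) (hφ : ∀ v, v ≠ 0 → 0 < φ v)
    (hc : IsCompact {x | ∃ hx : x ∈ C, φ ⟨x, hx⟩ = 1}) :
    IsConeBase C {x | ∃ hx : x ∈ C, φ ⟨x, hx⟩ = 1} where
  subset := fun _ hx => hx.1
  isCompact := hc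
  convex := by
    rintro x ⟨hx, hx1⟩ y ⟨hy, hy1⟩ a b ha hb hab
    have h := map_add φ ((⟨a, ha⟩ : {r : ℝ // 0 ≤ r}) • (⟨x, hx⟩ : C))
      ((⟨b, hb⟩ : {r : ℝ // 0 ≤ r}) • (⟨y, hy⟩ : C))
    rw [map_smul, map_smul, hx1, hy1] at h
    refine ⟨C.add_mem (C.smul_mem ha hx)
      (C.smul_mem hb hy), h.trans ?_⟩
    change a * 1 + b * 1 = 1
    linarith
  zero_notMem := by
    rintro ⟨h0, h⟩
    exact zero_ne_one ((map_zero φ).symm.trans h)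
  existsUnique_mem_ray := by
    intro v hv hv0
    have hpos : 0 < φ ⟨v, hv⟩ := hφ _ fun h => hv0 (congrArg Subtype.val h)
    have hmap : ∀ (r : ℝ) (hr : 0 ≤ r) (h : r • v ∈ C), φ ⟨r • v, h⟩ = r * φ ⟨v, hv⟩ :=
      fun r hr _ => map_smul φ (⟨r, hr⟩ : {r : ℝ // 0 ≤ r}) (⟨v, hv⟩ : C)
    have hinv := (inv_pos.2 hpos).le
    refine ⟨(φ ⟨v, hv⟩)⁻¹ • v,
      ⟨⟨C.smul_mem hinv hv, ?_⟩, _, hinv, rfl⟩, ?_⟩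
    · rw [hmap _ hinv, inv_mul_cancel₀ hpos.ne']
    · rintro _ ⟨⟨hy, hy1⟩, r, hr, rfl⟩
      rw [hmap r hr] at hy1
      rw [eq_inv_of_mul_eq_one_left hy1]

/-- A simplicial cone is described by finitely many coordinate functionals on the whole space. -/
theorem PointedCone.IsSimplicial.exists_coord {E : Type} [AddCommGroup E] [Module ℝ E]
    {C : PointedCone ℝ E} (hC : C.IsSimplicial) :
    ∃ (ι : Type) (_ : Fintype ι) (v : ι → E) (lam : ι → E →ₗ[ℝ] ℝ), (∀ i, v i ∈ C) ∧
      (∀ i, v i ≠ 0) ∧ ∀ x, x ∈ C ↔ (∀ i, 0 ≤ lam i x) ∧ ∑ i, lam i x • v i = x := by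
  classical
  obtain ⟨s, hs, hli, rfl⟩ := hC
  have : Fintype s := hs.fintype
  have hli' : LinearIndependent ℝ (fun i : s => (i : E)) := hli
  -- A linear left inverse extends the coordinates to all of `E`. Off the span of the generators its
  -- values are arbitrary; the equation `∑ i, lam i x • v i = x` excludes those points.
  obtain ⟨g, hg⟩ := LinearMap.exists_leftInverse_of_injective
    (Finsupp.linearCombination ℝ (fun i : s => (i : E))) (LinearMap.ker_eq_bot.2 hli')
  have hgv : ∀ i : s, g i = Finsupp.single i 1 := fun i => by
    have h := LinearMap.congr_fun hg (Finsupp.single i 1)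
    simpa using h
  refine ⟨s, this, fun i => i, fun i => (Finsupp.lapply i).comp g,
    fun i => PointedCone.subset_hull i.2, fun i => hli'.ne_zero i, fun x => ⟨fun hx => ?_, ?_⟩⟩
  · induction hx using Submodule.span_induction with
    | mem x hx =>
      have h := hgv ⟨x, hx⟩
      simp only at h
      refine ⟨fun i => ?_, ?_⟩
      · simp only [LinearMap.comp_apply, h, Finsupp.lapply_apply, Finsupp.single_apply]
        split_ifs <;> simp
      · simp [h, Finsupp.single_apply]
    | zero => simp
    | add x y _ _ hx hy =>
      refine ⟨fun i => ?_, ?_⟩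
      · rw [map_add]
        exact add_nonneg (hx.1 i) (hy.1 i)
      · simp only [map_add, add_smul, Finset.sum_add_distrib, hx.2, hy.2]
    | smul a x _ hx =>
      have ha : a • x = (a : ℝ) • x := rfl
      refine ⟨fun i => ?_, ?_⟩
      · rw [ha, map_smul]
        exact mul_nonneg a.2 (hx.1 i)
      · simp only [ha, map_smul, smul_eq_mul, mul_smul, ← Finset.smul_sum, hx.2]
  · rintro ⟨h0, h1⟩
    rw [← h1]
    exact Submodule.sum_mem _ fun i _ =>
      Submodule.smul_mem _ (⟨_, h0 i⟩ : {r : ℝ // 0 ≤ r}) (PointedCone.subset_hull i.2)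

theorem PointedCone.map_eq_sum_coord {C : PointedCone ℝ E} {ι : Type*} [Fintype ι] {v : ι → E}
    {lam : ι → E →ₗ[ℝ] ℝ} (hv : ∀ i, v i ∈ C) {F : Type*} [AddCommGroup F] [Module ℝ F]
    (T : C →ₗ[{r : ℝ // 0 ≤ r}] F) {x : E} (hx : x ∈ C) (h0 : ∀ i, 0 ≤ lam i x)
    (h1 : ∑ i, lam i x • v i = x) : T ⟨x, hx⟩ = ∑ i, lam i x • T ⟨v i, hv i⟩ := by
  have h : (⟨x, hx⟩ : C) = ∑ i, (⟨lam i x, h0 i⟩ : {r : ℝ // 0 ≤ r}) • (⟨v i, hv i⟩ : C) := by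
    apply Subtype.ext
    rw [AddSubmonoidClass.coe_finsetSum]
    exact h1.symm
  rw [h, map_sum]
  exact Finset.sum_congr rfl fun i _ => map_smul T _ _

end ConeBase

/-! ### From simplicial cones to a system of simplices -/

theorem exists_simplexSystem {m : ℕ → ℕ} {C : ∀ n, PointedCone ℝ (Fin (m n) → ℝ)}
    (hC : ∀ n, (C n).IsSimplicial) (f : ∀ n, C (n + 1) →ₗ[{r : ℝ // 0 ≤ r}] C n)
    (φ : ∀ n, C n →ₗ[{r : ℝ // 0 ≤ r}] ℝ) (hφ : ∀ n v, v ≠ 0 → 0 < φ n v)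
    (hφf : ∀ n v, φ n (f n v) = φ (n + 1) v) :
    ∃ S : SimplexSystem m, (∀ n, S.simplex n = {x | ∃ hx : x ∈ C n, φ n ⟨x, hx⟩ = 1}) ∧
      ∀ n x (hx : x ∈ C (n + 1)), S.map n x = f n ⟨x, hx⟩ := by
  choose ι hι v lam hv hv0 hmem using fun n => (hC n).exists_coord
  let a : ∀ n, ι n → ℝ := fun n i => φ n ⟨v n i, hv n i⟩
  have ha : ∀ n i, 0 < a n i := fun n i => hφ n _ fun h => hv0 n i (congrArg Subtype.val h)
  -- Generators are scaled onto the level set and coordinates inversely, so each product `coord n i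
  -- x • vertex n i` equals `lam n i x • v n i`, and the coordinates of a cone point sum to `φ n`.
  let vertex : ∀ n, ι n → Fin (m n) → ℝ := fun n i => (a n i)⁻¹ • v n i
  let coord : ∀ n, ι n → (Fin (m n) → ℝ) →ₗ[ℝ] ℝ := fun n i => a n i • lam n i
  -- A linear extension of `f n` to the whole space, prescribed on the generators.
  let map : ∀ n, (Fin (m (n + 1)) → ℝ) →ₗ[ℝ] (Fin (m n) → ℝ) := fun n =>
    ∑ i, (lam (n + 1) i).smulRight (f n ⟨v (n + 1) i, hv (n + 1) i⟩ : Fin (m n) → ℝ)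
  have hmap : ∀ n x (hx : x ∈ C (n + 1)), map n x = f n ⟨x, hx⟩ := by
    intro n x hx
    obtain ⟨h0, h1⟩ := (hmem (n + 1) x).1 hx
    have h := PointedCone.map_eq_sum_coord (hv (n + 1)) ((C n).subtype.comp (f n)) hx h0 h1
    simp only [LinearMap.comp_apply, Submodule.subtype_apply] at h
    rw [h]
    simp [map]
  have hsimplex : ∀ n, barycentricSimplex (vertex n) (coord n) =
      {x | ∃ hx : x ∈ C n, φ n ⟨x, hx⟩ = 1} := by
    intro n
    have hsum : ∀ x, ∑ i, coord n i x • vertex n i = ∑ i, lam n i x • v n i := fun x =>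
      Finset.sum_congr rfl fun i _ => by
        simp only [coord, vertex, LinearMap.smul_apply, smul_eq_mul, smul_smul]
        rw [mul_right_comm, mul_inv_cancel₀ (ha n i).ne', one_mul]
    have hnonneg : ∀ x, (∀ i, 0 ≤ coord n i x) ↔ ∀ i, 0 ≤ lam n i x := fun x =>
      forall_congr' fun i => by
        simp only [coord, LinearMap.smul_apply, smul_eq_mul]
        exact mul_nonneg_iff_of_pos_left (ha n i)
    have hφsum : ∀ x (hx : x ∈ C n), φ n ⟨x, hx⟩ = ∑ i, coord n i x := by
      intro x hx
      obtain ⟨h0, h1⟩ := (hmem n x).1 hx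
      rw [PointedCone.map_eq_sum_coord (hv n) (φ n) hx h0 h1]
      exact Finset.sum_congr rfl fun i _ => mul_comm _ _
    ext x
    constructor
    · rintro ⟨h0, h1, h2⟩
      have hx : x ∈ C n := (hmem n x).2 ⟨(hnonneg x).1 h0, (hsum x).symm.trans h2⟩
      exact ⟨hx, (hφsum x hx).trans h1⟩
    · rintro ⟨hx, h1⟩
      obtain ⟨h0, h2⟩ := (hmem n x).1 hx
      exact ⟨(hnonneg x).2 h0, (hφsum x hx).symm.trans h1, (hsum x).trans h2⟩
  have hvertex : ∀ n i, vertex n i ∈ barycentricSimplex (vertex n) (coord n) := by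
    intro n i
    have hinv := (inv_pos.2 (ha n i)).le
    rw [hsimplex]
    refine ⟨(C n).smul_mem hinv (hv n i), ?_⟩
    refine (map_smul (φ n) (⟨_, hinv⟩ : {r : ℝ // 0 ≤ r}) (⟨v n i, hv n i⟩ : C n)).trans ?_
    exact inv_mul_cancel₀ (ha n i).ne'
  refine ⟨{ ι := ι, vertex := vertex, coord := coord, map := map, vertex_mem := hvertex,
            map_vertex_mem := fun n i => ?_ }, hsimplex, hmap⟩
  have h := hvertex (n + 1) i
  rw [hsimplex] at h ⊢
  obtain ⟨hx, h1⟩ := h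
  rw [hmap n _ hx]
  exact ⟨(f n ⟨_, hx⟩).2, (hφf n _).trans h1⟩

/-! ### The limit cone and the main theorem -/

section Limit

variable {m : ℕ → ℕ} {C : ∀ n, PointedCone ℝ (Fin (m n) → ℝ)}

/-- The projection of the limit cone to the first cone. -/
def limitConeFst (f : ∀ n, C (n + 1) →ₗ[{r : ℝ // 0 ≤ r}] C n) :
    limitCone f →ₗ[{r : ℝ // 0 ≤ r}] C 0 where
  toFun x := ⟨x.1 0, x.2.1 0⟩
  map_add' _ _ := rfl
  map_smul' _ _ := rfl

variable {f : ∀ n, C (n + 1) →ₗ[{r : ℝ // 0 ≤ r}] C n}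

theorem toFirst_ne_zero (hf : ∀ n, ∀ v : C (n + 1), f n v = 0 → v = 0) (n : ℕ) {v : C n}
    (hv : v ≠ 0) : toFirst f n v ≠ 0 := by
  induction n with
  | zero => exact hv
  | succ n ih => exact ih fun h => hv (hf n v h)

theorem toFirst_of_mem_limitCone {x : ∀ n, Fin (m n) → ℝ} (hx : x ∈ limitCone f) (n : ℕ) :
    toFirst f n ⟨x n, hx.1 n⟩ = ⟨x 0, hx.1 0⟩ := by
  induction n with
  | zero => rfl
  | succ n ih =>
    rw [← ih, ← hx.2 n]
    rfl

theorem limitConeFst_ne_zero (hf : ∀ n, ∀ v : C (n + 1), f n v = 0 → v = 0) {x : limitCone f}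
    (hx : x ≠ 0) : limitConeFst f x ≠ 0 := by
  intro h
  refine hx (Subtype.ext (funext fun n => ?_))
  by_contra hn
  exact toFirst_ne_zero hf n (v := ⟨x.1 n, x.2.1 n⟩) (fun h0 => hn (congrArg Subtype.val h0))
    ((toFirst_of_mem_limitCone x.2 n).trans h)

end Limit

theorem mainTheorem9 (m : ℕ → ℕ) (C : ∀ n, PointedCone ℝ (Fin (m n) → ℝ))
    (hC : ∀ n, (C n).IsSimplicial)
    (f : ∀ n, C (n + 1) →ₗ[{r : ℝ // 0 ≤ r}] C n)
    (hf : ∀ n, ∀ v : C (n + 1), f n v = 0 → v = 0)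
    (B : Set (Fin (m 0) → ℝ)) (hB : IsConeBase (C 0) B) :
    (∀ n, IsConeBase (C n) (pullbackBase f B n)) ∧
      IsConeBase (limitCone f) (limitSet f (pullbackBase f B)) ∧
      IsCompact (limitSet f (pullbackBase f B)) ∧
      TopologicalSpace.MetrizableSpace (limitSet f (pullbackBase f B)) ∧
      IsChoquetSimplex (limitSet f (pullbackBase f B)) := by
  obtain ⟨φ, hφ, hφB⟩ := hB.exists_functional
  let φn : ∀ n, C n →ₗ[{r : ℝ // 0 ≤ r}] ℝ := fun n => φ.comp (toFirst f n)
  have hφn : ∀ n v, v ≠ 0 → 0 < φn n v := fun n v hv => hφ _ (toFirst_ne_zero hf n hv)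
  have hpull : ∀ n, pullbackBase f B n = {x | ∃ hx : x ∈ C n, φn n ⟨x, hx⟩ = 1} := by
    intro n
    ext x
    refine exists_congr fun hx => (hφB _).trans ⟨fun ⟨_, h⟩ => h, fun h => ⟨Subtype.coe_prop _, h⟩⟩
  obtain ⟨S, hS, hSmap⟩ := exists_simplexSystem hC f φn hφn fun _ _ => rfl
  have hlimit : limitSet f (pullbackBase f B) = S.limit := by
    ext x
    constructor
    · rintro ⟨⟨hx, hfx⟩, hxB⟩
      refine ⟨fun n => ?_, fun n => ?_⟩
      · rw [hS, ← hpull]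
        exact hxB n
      · rw [hSmap n _ (hx (n + 1)), hfx n]
    · rintro ⟨hx, hfx⟩
      have hxB : ∀ n, x n ∈ pullbackBase f B n := fun n => by
        rw [hpull, ← hS]
        exact hx n
      exact ⟨⟨fun n => (hxB n).1, fun n => Subtype.ext
        ((hSmap n _ (hxB (n + 1)).1).symm.trans (hfx n))⟩, hxB⟩
  -- All components of a thread have the same image in `C 0`, so the condition at level `0` implies
  -- all the others.
  have hfst : limitSet f (pullbackBase f B) =
      {x | ∃ hx : x ∈ limitCone f, φ.comp (limitConeFst f) ⟨x, hx⟩ = 1} := by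
    ext x
    constructor
    · rintro ⟨hx, hxB⟩
      have h := hxB 0
      rw [hpull] at h
      exact ⟨hx, h.2⟩
    · rintro ⟨hx, h⟩
      refine ⟨hx, fun n => ?_⟩
      rw [hpull]
      exact ⟨hx.1 n, (congrArg φ (toFirst_of_mem_limitCone hx n)).trans h⟩
  have hcompact : IsCompact (limitSet f (pullbackBase f B)) := hlimit ▸ S.isCompact_limit
  refine ⟨fun n => ?_, ?_, hcompact, inferInstance, hlimit ▸ S.isChoquetSimplex_limit⟩
  · rw [hpull]
    exact isConeBase_of_functional (φn n) (hφn n) (hS n ▸ S.isCompact_simplex n)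
  · rw [hfst] at hcompact ⊢
    exact isConeBase_of_functional _ (fun v hv => hφ _ (limitConeFst_ne_zero hf hv)) hcompact
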